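/- Let $n\ge 1$ be an integer and let $A_1,\dots,A_{2n+1}$ be strictly positive (i.e. positive and invertible) bounded linear operators on a complex Hilbert space. For real numbers $t_1,\dots,t_n$, $p_1,\dots,p_{2n}$ put $\psi[0]=1$ and $$\psi[2m]=\bigl(\psi[2m-2]\,p_{2m-1}-t_m\bigr)p_{2m}+t_m\qquad(1\le m\le n),$$ so that $\psi[2n]=\{\cdots[\{[(p_1-t_1)p_2+t_1]p_3-t_2\}p_4+t_2]p_5-\cdots-t_n\}p_{2n}+t_n$. For strictly positive operators $B_1,\dots,B_{2n}$ put $$N_1(B)=\bigl(B_2^{-t_1/2}B_1^{p_1}B_2^{-t_1/2}\bigr)^{p_2},\qquad N_m(B)=\Bigl[B_{2m}^{-t_m/2}\bigl\{B_{2m-1}^{t_{m-1}/2}\,N_{m-1}(B)\,B_{2m-1}^{t_{m-1}/2}\bigr\}^{p_{2m-1}}B_{2m}^{-t_m/2}\Bigr]^{p_{2m}}\quad(2\le m\le n).$$ Then the following two assertions are equivalent. (I) $A_{2n+1}\ge A_{2n}\ge\cdots\ge A_2\ge A_1$. (II) For all $t_1,\dots,t_n\in[0,1]$, all $p_1,\dots,p_{2n}\ge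 1$ and all $r\ge t_n$, the following $2n$ inequalities hold: for every $k=1,\dots,n$, $$\text{(II.}k\text{)}\qquad A_{2n+1}^{\,r-t_n}\ \ge\ \Bigl\{A_{2n+1}^{r/2}\,N_n\bigl(B^{(k)}\bigr)\,A_{2n+1}^{r/2}\Bigr\}^{\frac{r-t_n}{\psi[2n]-t_n+r}},\qquad B^{(k)}_j=A_{\min(k+j-1,\,2n+1)},$$ and $$\text{(II.}(2n+1-k)\text{)}\qquad A_1^{\,r-t_n}\ \le\ \Bigl\{A_1^{r/2}\,N_n\bigl(C^{(k)}\bigr)\,A_1^{r/2}\Bigr\}^{\frac{r-t_n}{\psi[2n]-t_n+r}},\qquad C^{(k)}_j=A_{2n+2-\min(k+j-1,\,2n+1)}\qquad(1\le j\le 2n).$$ -/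

import Mathlib

noncomputable section

/-- The number `ψ[2m]`, where
`ψ[2m] = {⋯[{[(p₁ - t₁)p₂ + t₁]p₃ - t₂}p₄ + t₂]p₅ - ⋯ - tₘ}p₂ₘ + tₘ`
(with the convention `ψ[0] = 1`, so that `ψ[2] = (p₁ - t₁)p₂ + t₁`). -/
def furutaPsi (p t : ℕ → ℝ) : ℕ → ℝ
  | 0 => 1
  | m + 1 => (furutaPsi p t m * p (2 * m + 1) - t (m + 1)) * p (2 * m + 2) + t (m + 1)

/-- The nested expression with `2m` powers,
`[B₂ₘ^(-tₘ/2) {B₂ₘ₋₁^(tₘ₋₁/2) ⋯ {B₃^(t₁/2) (B₂^(-t₁/2) B₁^p₁ B₂^(-t₁/2))^p₂ B₃^(t₁/2)}^p₃ ⋯`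
`B₂ₘ₋₁^(tₘ₋₁/2)}^p₂ₘ₋₁ B₂ₘ^(-tₘ/2)]^p₂ₘ`,
for `m ≥ 1`. The value at `m = 0` is a dummy. Powers with real exponents are those of the
continuous functional calculus. -/
def furutaNested {H : Type*} [NormedAddCommGroup H] [InnerProductSpace ℂ H] [CompleteSpace H]
    (B : ℕ → H →L[ℂ] H) (p t : ℕ → ℝ) : ℕ → H →L[ℂ] H
  | 0 => B 1
  | 1 => (B 2 ^ (-(t 1 / 2)) * B 1 ^ p 1 * B 2 ^ (-(t 1 / 2))) ^ p 2
  | m + 2 =>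
      (B (2 * m + 4) ^ (-(t (m + 2) / 2)) *
        (B (2 * m + 3) ^ (t (m + 1) / 2) * furutaNested B p t (m + 1) *
          B (2 * m + 3) ^ (t (m + 1) / 2)) ^ p (2 * m + 3) *
        B (2 * m + 4) ^ (-(t (m + 2) / 2))) ^ p (2 * m + 4)

/-- The operator `{C^(r/2) [nested expression in B₁, …, B₂ₙ] C^(r/2)}^((r - tₙ)/(ψ[2n] - tₙ + r))`. -/
def furutaExpr {H : Type*} [NormedAddCommGroup H] [InnerProductSpace ℂ H] [CompleteSpace H]
    (n : ℕ) (C : H →L[ℂ] H) (B : ℕ → H →L[ℂ] H) (p t : ℕ → ℝ) (r : ℝ) : H →L[ℂ] H :=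
  (C ^ (r / 2) * furutaNested B p t n * C ^ (r / 2)) ^
    ((r - t n) / (furutaPsi p t n - t n + r))

end

/-! From the chain to the inequalities, the engine is a three-operator grand Furuta inequality for a
≤ b ≤ c, `grand_furuta_three`. At the critical outer exponent t its conclusion is again an operator
below c. That operator can serve as the smallest one at the next level of the nest, so the nested
bound follows by induction. One application of the Furuta inequality then raises the outer exponent
from tₙ to r. The underlying tools are Löwner–Heinz monotonicity, Furuta's lemma on powers of z z*,
and monotonicity of the geometric mean in both arguments.

Conversely, each inequality yields one link B₁ ≤ B₂. Setting every parameter to 1 except p₂ = s and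
r = 2 turns it into a bound, uniform in s, on a fixed conjugate of X ^ s with X = B₂^(-1/2) B₁
B₂^(-1/2). This forces X ≤ 1. The lower bounds by A₁ are the upper bounds for the inverses, whose
order is reversed. -/

section CStarAlgebra

variable {𝒜 : Type*} [CStarAlgebra 𝒜] [PartialOrder 𝒜] [StarOrderedRing 𝒜]

/-! ### Real powers, conjugation and inversion. -/

namespace IsStrictlyPositive

theorem star_right_conjugate {a c : 𝒜} (ha : IsStrictlyPositive a) (hc : IsUnit c) :
    IsStrictlyPositive (c * a * star c) :=
  ⟨star_right_conjugate_nonneg ha.nonneg c, (hc.mul ha.isUnit).mul hc.star⟩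

theorem conjugate {a c : 𝒜} (ha : IsStrictlyPositive a) (hc : IsStrictlyPositive c) :
    IsStrictlyPositive (c * a * c) := by
  simpa [hc.isSelfAdjoint.star_eq] using ha.star_right_conjugate hc.isUnit

theorem rpow_const {a : 𝒜} (ha : IsStrictlyPositive a) (x : ℝ) : IsStrictlyPositive (a ^ x) :=
  .rpow a x ha

theorem rpow_rpow {a : 𝒜} (ha : IsStrictlyPositive a) (x y : ℝ) :
    (a ^ x) ^ y = a ^ (x * y) := by
  rcases eq_or_ne x 0 with rfl | hx
  · rw [CFC.rpow_zero a ha.nonneg, zero_mul, CFC.rpow_zero a ha.nonneg, CFC.one_rpow]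
  · exact CFC.rpow_rpow a x y hx ha

theorem rpow_add {a : 𝒜} (ha : IsStrictlyPositive a) (x y : ℝ) :
    a ^ (x + y) = a ^ x * a ^ y :=
  CFC.rpow_add ha.isUnit

theorem rpow_mul_rpow_mul_rpow {a : 𝒜} (ha : IsStrictlyPositive a) (x y z : ℝ) :
    a ^ x * a ^ y * a ^ z = a ^ (x + y + z) := by
  rw [ha.rpow_add, ha.rpow_add]

theorem rpow_mul_cancel_left {a : 𝒜} (ha : IsStrictlyPositive a) (x : ℝ) (b : 𝒜) :
    a ^ x * (a ^ (-x) * b) = b := by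
  rw [← mul_assoc, CFC.rpow_mul_rpow_neg x ha, one_mul]

theorem conjugate_rpow_conjugate_rpow {a : 𝒜} (ha : IsStrictlyPositive a) (x y : ℝ) (b : 𝒜) :
    a ^ x * (a ^ y * b * a ^ y) * a ^ x = a ^ (x + y) * b * a ^ (x + y) := by
  calc _ = (a ^ x * a ^ y) * b * (a ^ y * a ^ x) := by simp only [mul_assoc]
    _ = _ := by rw [← ha.rpow_add, ← ha.rpow_add, add_comm y x]

theorem conjugate_rpow_conjugate_rpow_neg {a : 𝒜} (ha : IsStrictlyPositive a) (x : ℝ) (b : 𝒜) :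
    a ^ x * (a ^ (-x) * b * a ^ (-x)) * a ^ x = b := by
  rw [mul_assoc, mul_assoc, CFC.rpow_neg_mul_rpow x ha, mul_one, ha.rpow_mul_cancel_left]

theorem conjugate_rpow_neg_conjugate_rpow {a : 𝒜} (ha : IsStrictlyPositive a) (x : ℝ) (b : 𝒜) :
    a ^ (-x) * (a ^ x * b * a ^ x) * a ^ (-x) = b := by
  simpa using ha.conjugate_rpow_conjugate_rpow_neg (-x) b

theorem rpow_neg_one_unique {a b : 𝒜} (ha : IsStrictlyPositive a) (h : a * b = 1) :
    a ^ (-1 : ℝ) = b := by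
  have := CFC.rpow_neg_mul_rpow 1 ha
  rw [CFC.rpow_one a ha.nonneg] at this
  exact left_inv_eq_right_inv this h

theorem conjugate_rpow_neg_one {a c : 𝒜} (ha : IsStrictlyPositive a) (hc : IsStrictlyPositive c) :
    (c * a * c) ^ (-1 : ℝ) = c ^ (-1 : ℝ) * a ^ (-1 : ℝ) * c ^ (-1 : ℝ) := by
  refine (ha.conjugate hc).rpow_neg_one_unique ?_
  have h1 := CFC.rpow_mul_rpow_neg 1 ha
  have h2 := CFC.rpow_mul_rpow_neg 1 hc
  rw [CFC.rpow_one _ ha.nonneg] at h1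
  rw [CFC.rpow_one _ hc.nonneg] at h2
  calc c * a * c * (c ^ (-1 : ℝ) * a ^ (-1 : ℝ) * c ^ (-1 : ℝ))
      = c * (a * (c * c ^ (-1 : ℝ)) * a ^ (-1 : ℝ)) * c ^ (-1 : ℝ) := by simp only [mul_assoc]
    _ = 1 := by rw [h2, mul_one, h1, mul_one, h2]

theorem rpow_neg_one_anti {a b : 𝒜} (ha : IsStrictlyPositive a) (hab : a ≤ b) :
    b ^ (-1 : ℝ) ≤ a ^ (-1 : ℝ) := by
  rw [← CFC.inverse_eq_rpow_neg_one ha, ← CFC.inverse_eq_rpow_neg_one (ha.of_le hab)]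
  exact CStarAlgebra.ringInverse_le_ringInverse hab ha

theorem rpow_neg_one_rpow_neg_one {a : 𝒜} (ha : IsStrictlyPositive a) :
    (a ^ (-1 : ℝ)) ^ (-1 : ℝ) = a := by
  rw [ha.rpow_rpow]; norm_num; exact CFC.rpow_one a ha.nonneg

theorem rpow_neg_one_le_rpow_neg_one_iff {a b : 𝒜} (ha : IsStrictlyPositive a)
    (hb : IsStrictlyPositive b) : b ^ (-1 : ℝ) ≤ a ^ (-1 : ℝ) ↔ a ≤ b := by
  refine ⟨fun h ↦ ?_, ha.rpow_neg_one_anti⟩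
  simpa only [ha.rpow_neg_one_rpow_neg_one, hb.rpow_neg_one_rpow_neg_one] using
    (hb.rpow_const (-1)).rpow_neg_one_anti h

theorem rpow_neg_anti {a b : 𝒜} (ha : IsStrictlyPositive a) (hab : a ≤ b) {r : ℝ}
    (hr : r ∈ Set.Icc (0 : ℝ) 1) : b ^ (-r) ≤ a ^ (-r) := by
  have := (ha.rpow_const r).rpow_neg_one_anti (CFC.rpow_le_rpow hr hab)
  simpa [ha.rpow_rpow, (ha.of_le hab).rpow_rpow] using this

end IsStrictlyPositive

theorem conjugate_rpow_le_conjugate_rpow {a b : 𝒜} (hab : a ≤ b) (c : 𝒜) (x : ℝ) :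
    c ^ x * a * c ^ x ≤ c ^ x * b * c ^ x :=
  conjugate_le_conjugate_of_nonneg hab CFC.rpow_nonneg

theorem unitary_conjugate_rpow {u a : 𝒜} (hu : u ∈ unitary 𝒜) (ha : IsStrictlyPositive a) (x : ℝ) :
    (u * a * star u) ^ x = u * a ^ x * star u := by
  let φ := Unitary.conjStarAlgAut ℂ 𝒜 ⟨u, hu⟩
  have hφ : Continuous φ := by
    have : (φ : 𝒜 → 𝒜) = fun y ↦ u * y * star u := rfl
    rw [this]; fun_prop
  have hpos : 0 ≤ φ a := star_right_conjugate_nonneg ha.nonneg u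
  -- Invertibility keeps 0 out of the spectrum, so negative exponents are allowed.
  have hc : ContinuousOn (fun y : NNReal ↦ y ^ x) (spectrum NNReal a) := by
    refine NNReal.continuousOn_rpow_const (.inl ?_)
    exact spectrum.zero_notMem _ ha.isUnit
  have := StarAlgHomClass.map_cfc (R := NNReal) (S := ℂ) φ (fun y : NNReal ↦ y ^ x) a hc hφ
    ha.nonneg hpos
  exact this.symm

/-- Furuta's lemma: powers of `z z*` in terms of powers of `z* z`. -/
theorem IsUnit.mul_star_rpow {z : 𝒜} (hz : IsUnit z) (x : ℝ) :
    (z * star z) ^ x = z * (star z * z) ^ (x - 1) * star z := by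
  have hP : IsStrictlyPositive (star z * z) :=
    ⟨star_mul_self_nonneg z, hz.star.mul hz⟩
  set P := star z * z with hPdef
  -- The unitary factor of the polar decomposition z = u P^(1/2). Then z z* = u P u*, and powers
  -- pass through u.
  set u := z * P ^ (-(1 / 2) : ℝ) with hu
  have hs : star u = P ^ (-(1 / 2) : ℝ) * star z := by
    rw [hu, star_mul, (hP.rpow_const _).isSelfAdjoint.star_eq]
  have hzu : z = u * P ^ (1 / 2 : ℝ) := by
    rw [hu, mul_assoc, CFC.rpow_neg_mul_rpow _ hP, mul_one]
  have hsz : star z = P ^ (1 / 2 : ℝ) * star u := by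
    rw [hs, hP.rpow_mul_cancel_left]
  have hsu : star u * u = 1 := by
    rw [hs, hu, ← mul_assoc, mul_assoc _ (star z) z, ← hPdef]
    nth_rw 2 [← CFC.rpow_one P hP.nonneg]
    rw [hP.rpow_mul_rpow_mul_rpow]
    norm_num
    exact CFC.rpow_zero P hP.nonneg
  have huu : IsUnit u := hz.mul (hP.rpow_const _).isUnit
  have hmem : u ∈ unitary 𝒜 := by
    refine ⟨hsu, ?_⟩
    obtain ⟨v, hv⟩ := huu.exists_right_inv
    rwa [left_inv_eq_right_inv hsu hv]
  have h1 : z * star z = u * P * star u := by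
    calc z * star z = (u * P ^ (1 / 2 : ℝ)) * (P ^ (1 / 2 : ℝ) * star u) := by rw [← hzu, ← hsz]
      _ = u * (P ^ (1 / 2 : ℝ) * P ^ (1 / 2 : ℝ)) * star u := by simp only [mul_assoc]
      _ = u * P * star u := by
        rw [← hP.rpow_add, add_halves, CFC.rpow_one P hP.nonneg]
  have h2 : P ^ (1 / 2 : ℝ) * P ^ (x - 1) * P ^ (1 / 2 : ℝ) = P ^ x := by
    rw [hP.rpow_mul_rpow_mul_rpow]; congr 1; ring
  rw [h1, unitary_conjugate_rpow hmem hP, ← h2]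
  calc _ = (u * P ^ (1 / 2 : ℝ)) * P ^ (x - 1) * (P ^ (1 / 2 : ℝ) * star u) := by
        simp only [mul_assoc]
    _ = _ := by rw [← hzu, ← hsz]

/-! ### Weighted geometric means. -/

/-- The weighted geometric mean `a #ₓ b` of strictly positive elements. -/
noncomputable def geomMean (a : 𝒜) (x : ℝ) (b : 𝒜) : 𝒜 :=
  a ^ (1 / 2 : ℝ) * (a ^ (-(1 / 2) : ℝ) * b * a ^ (-(1 / 2) : ℝ)) ^ x * a ^ (1 / 2 : ℝ)

/-- Furuta's lemma for z = a^(-1/2) b^(1/2) trades the exponent x for x - 1; inverting the base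
makes it 1 - x. This symmetry gives monotonicity in the left argument. -/
theorem geomMean_comm {a b : 𝒜} (ha : IsStrictlyPositive a) (hb : IsStrictlyPositive b) (x : ℝ) :
    geomMean a x b = geomMean b (1 - x) a := by
  set z := a ^ (-(1 / 2) : ℝ) * b ^ (1 / 2 : ℝ) with hz
  have hzu : IsUnit z := (ha.rpow_const _).isUnit.mul (hb.rpow_const _).isUnit
  have hs : star z = b ^ (1 / 2 : ℝ) * a ^ (-(1 / 2) : ℝ) := by
    rw [hz, star_mul, (ha.rpow_const _).isSelfAdjoint.star_eq,
      (hb.rpow_const _).isSelfAdjoint.star_eq]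
  have h1 : a ^ (-(1 / 2) : ℝ) * b * a ^ (-(1 / 2) : ℝ) = z * star z := by
    nth_rw 1 [← CFC.rpow_one b hb.nonneg]
    rw [hs, hz, show (1 : ℝ) = 1 / 2 + 1 / 2 by norm_num, hb.rpow_add]
    norm_num [mul_assoc]
  have h2 : (star z * z) ^ (-1 : ℝ) = b ^ (-(1 / 2) : ℝ) * a * b ^ (-(1 / 2) : ℝ) := by
    have : star z * z = b ^ (1 / 2 : ℝ) * a ^ (-1 : ℝ) * b ^ (1 / 2 : ℝ) := by
      rw [hs, hz, show (-1 : ℝ) = -(1 / 2) + -(1 / 2) by norm_num, ha.rpow_add]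
      simp only [mul_assoc]
    rw [this, (ha.rpow_const _).conjugate_rpow_neg_one (hb.rpow_const _),
      ha.rpow_neg_one_rpow_neg_one,
      hb.rpow_rpow]
    norm_num
  have hP : IsStrictlyPositive (star z * z) := ⟨star_mul_self_nonneg z, hzu.star.mul hzu⟩
  have h3 : (star z * z) ^ (x - 1) = (b ^ (-(1 / 2) : ℝ) * a * b ^ (-(1 / 2) : ℝ)) ^ (1 - x) := by
    rw [← h2, hP.rpow_rpow]; congr 1; ring
  have h4 : a ^ (1 / 2 : ℝ) * z = b ^ (1 / 2 : ℝ) := ha.rpow_mul_cancel_left _ _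
  have h5 : star z * a ^ (1 / 2 : ℝ) = b ^ (1 / 2 : ℝ) := by
    rw [hs, mul_assoc, CFC.rpow_neg_mul_rpow _ ha, mul_one]
  rw [geomMean, h1, hzu.mul_star_rpow, geomMean, h3]
  calc _ = (a ^ (1 / 2 : ℝ) * z) * (b ^ (-(1 / 2) : ℝ) * a * b ^ (-(1 / 2) : ℝ)) ^ (1 - x) *
        (star z * a ^ (1 / 2 : ℝ)) := by simp only [mul_assoc]
    _ = _ := by rw [h4, h5]

theorem geomMean_mono_right (a : 𝒜) {b c : 𝒜} (hbc : b ≤ c) {x : ℝ}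
    (hx : x ∈ Set.Icc (0 : ℝ) 1) : geomMean a x b ≤ geomMean a x c :=
  conjugate_rpow_le_conjugate_rpow
    (CFC.rpow_le_rpow hx (conjugate_rpow_le_conjugate_rpow hbc _ _)) _ _

theorem geomMean_mono_left {a b c : 𝒜} (ha : IsStrictlyPositive a) (hc : IsStrictlyPositive c)
    (hab : a ≤ b) {x : ℝ} (hx : x ∈ Set.Icc (0 : ℝ) 1) : geomMean a x c ≤ geomMean b x c := by
  rw [geomMean_comm ha hc, geomMean_comm (ha.of_le hab) hc]
  exact geomMean_mono_right c hab ⟨by linarith [hx.2], by linarith [hx.1]⟩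

theorem geomMean_rpow_neg {a : 𝒜} (ha : IsStrictlyPositive a) (r x : ℝ) (b : 𝒜) :
    geomMean (a ^ (-r)) x b =
      a ^ (-(r / 2)) * (a ^ (r / 2) * b * a ^ (r / 2)) ^ x * a ^ (-(r / 2)) := by
  rw [geomMean, ha.rpow_rpow, ha.rpow_rpow]
  ring_nf

/-- Since a^(-r) ≤ b^(-r), the mean of a^(-r) and c is below that of b^(-r) and c. Conjugating by
a^(r/2) clears the outer factors. This replaces the outer operator b by a larger a. -/
theorem conjugate_rpow_le_of_le {a b c : 𝒜} (hb : IsStrictlyPositive b)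
    (hc : IsStrictlyPositive c) (hba : b ≤ a) {r x s : ℝ} (hr : r ∈ Set.Icc (0 : ℝ) 1)
    (hx : x ∈ Set.Icc (0 : ℝ) 1)
    (h : b ^ (-(r / 2)) * (b ^ (r / 2) * c * b ^ (r / 2)) ^ x * b ^ (-(r / 2)) ≤ a ^ s) :
    (a ^ (r / 2) * c * a ^ (r / 2)) ^ x ≤ a ^ (s + r) := by
  have ha := hb.of_le hba
  have h1 := geomMean_mono_left (ha.rpow_const (-r)) hc (hb.rpow_neg_anti hba hr) hx
  rw [geomMean_rpow_neg ha, geomMean_rpow_neg hb] at h1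
  have h2 := conjugate_rpow_le_conjugate_rpow (h1.trans h) a (r / 2)
  rw [ha.conjugate_rpow_conjugate_rpow_neg, ha.rpow_mul_rpow_mul_rpow] at h2
  convert h2 using 2
  ring

/-! ### The Furuta inequality. -/

/-- The Furuta inequality with outer exponent `r ≤ 1`. -/
theorem furuta_inequality_of_le_one {a b : 𝒜} (hb : IsStrictlyPositive b) (hba : b ≤ a)
    {q r : ℝ} (hq : 1 ≤ q) (hr : r ∈ Set.Icc (0 : ℝ) 1) :
    (a ^ (r / 2) * b ^ q * a ^ (r / 2)) ^ ((1 + r) / (q + r)) ≤ a ^ (1 + r) := by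
  have h0 := hr.1
  have hqr : 0 < q + r := by linarith
  refine conjugate_rpow_le_of_le hb (hb.rpow_const q) hba hr
    ⟨by positivity, (div_le_one hqr).2 (by linarith)⟩ ?_
  rw [hb.rpow_mul_rpow_mul_rpow, hb.rpow_rpow, hb.rpow_mul_rpow_mul_rpow]
  have : -(r / 2) + (r / 2 + q + r / 2) * ((1 + r) / (q + r)) + -(r / 2) = 1 := by
    field_simp; ring
  rw [this, CFC.rpow_one b hb.nonneg, CFC.rpow_one a (hb.of_le hba).nonneg]
  exact hba

/-- The Furuta inequality. -/
theorem furuta_inequality {a b : 𝒜} (hb : IsStrictlyPositive b) (hba : b ≤ a)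
    {q r : ℝ} (hq : 1 ≤ q) (hr : 0 ≤ r) :
    (a ^ (r / 2) * b ^ q * a ^ (r / 2)) ^ ((1 + r) / (q + r)) ≤ a ^ (1 + r) := by
  -- Induction on the number of halvings of 1 + r needed to reach the case r ≤ 1.
  obtain ⟨n, hn⟩ := pow_unbounded_of_one_lt (1 + r) (one_lt_two)
  induction n generalizing r with
  | zero => norm_num at hn; linarith
  | succ n ih =>
    rcases le_total r 1 with h1 | h1
    · exact furuta_inequality_of_le_one hb hba hq ⟨hr, h1⟩
    have ha := hb.of_le hba
    obtain ⟨e, rfl⟩ : ∃ e, r = 2 * e + 1 := ⟨(r - 1) / 2, by ring⟩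
    have he : 0 ≤ e := by linarith
    have hle := ih he (by rw [pow_succ] at hn; linarith)
    have hsp := ((hb.rpow_const q).conjugate (ha.rpow_const (e / 2)))
    have hqe : 0 < q + e := by linarith
    have he1 : 0 < 1 + e := by linarith
    -- The inequality for e is itself an order relation below a^(1+e). Applying the case r = 1 to
    -- it, with q chosen to undo its power, gives outer exponent 2e + 1.
    have key := furuta_inequality_of_le_one (hsp.rpow_const _) hle (q := (q + e) / (1 + e)) (r := 1)
      ((one_le_div he1).2 (by linarith)) ⟨zero_le_one, le_rfl⟩
    rw [hsp.rpow_rpow, ha.rpow_rpow, ha.rpow_rpow,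
      show (1 + e) / (q + e) * ((q + e) / (1 + e)) = 1 by field_simp,
      CFC.rpow_one _ hsp.nonneg] at key
    have h2 : a ^ ((1 + e) * (1 / 2)) * (a ^ (e / 2) * b ^ q * a ^ (e / 2)) *
        a ^ ((1 + e) * (1 / 2)) =
        a ^ ((2 * e + 1) / 2) * b ^ q * a ^ ((2 * e + 1) / 2) := by
      rw [ha.conjugate_rpow_conjugate_rpow]
      ring_nf
    rw [h2] at key
    convert key using 2
    · field_simp; ring
    · ring

/-! ### The grand Furuta inequality. -/

/-- The inner exponent of the grand Furuta inequality is at least one. -/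
theorem one_le_sub_mul_add {p t s : ℝ} (hp : 1 ≤ p) (ht : t ∈ Set.Icc (0 : ℝ) 1) (hs : 1 ≤ s) :
    1 ≤ (p - t) * s + t := by
  nlinarith [ht.2, mul_nonneg (sub_nonneg.2 (ht.2.trans hp)) (sub_nonneg.2 hs)]

/-- Furuta's lemma lowers the power s to s - 1, which lies in [0, 1]. Löwner–Heinz then allows
a^(-t) to be replaced by b^(-t), leaving only powers of b. -/
theorem grand_furuta_inner_of_le_two {a b : 𝒜} (hb : IsStrictlyPositive b) (hba : b ≤ a)
    {p t s : ℝ} (hp : 1 ≤ p) (ht : t ∈ Set.Icc (0 : ℝ) 1) (hs : s ∈ Set.Icc (1 : ℝ) 2) :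
    (a ^ (t / 2) * (a ^ (-(t / 2)) * b ^ p * a ^ (-(t / 2))) ^ s * a ^ (t / 2)) ^
      (1 / ((p - t) * s + t)) ≤ b := by
  have ha := hb.of_le hba
  have hq := one_le_sub_mul_add hp ht hs.1
  set z := a ^ (-(t / 2)) * b ^ (p / 2) with hz
  have hzu : IsUnit z := (ha.rpow_const _).isUnit.mul (hb.rpow_const _).isUnit
  have hstar : star z = b ^ (p / 2) * a ^ (-(t / 2)) := by
    rw [hz, star_mul, (ha.rpow_const _).isSelfAdjoint.star_eq,
      (hb.rpow_const _).isSelfAdjoint.star_eq]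
  have h1 : a ^ (-(t / 2)) * b ^ p * a ^ (-(t / 2)) = z * star z := by
    rw [hstar, hz]
    nth_rw 1 [show p = p / 2 + p / 2 by ring]
    rw [hb.rpow_add]
    simp only [mul_assoc]
  have h2 : star z * z = b ^ (p / 2) * a ^ (-t) * b ^ (p / 2) := by
    rw [hstar, hz, show -t = -(t / 2) + -(t / 2) by ring, ha.rpow_add]
    simp only [mul_assoc]
  have h3 : a ^ (t / 2) * (z * star z) ^ s * a ^ (t / 2) =
      b ^ (p / 2) * (b ^ (p / 2) * a ^ (-t) * b ^ (p / 2)) ^ (s - 1) * b ^ (p / 2) := by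
    have h5 : a ^ (t / 2) * z = b ^ (p / 2) := ha.rpow_mul_cancel_left _ _
    have h6 : star z * a ^ (t / 2) = b ^ (p / 2) := by
      rw [hstar, mul_assoc, CFC.rpow_neg_mul_rpow _ ha, mul_one]
    rw [hzu.mul_star_rpow, h2]
    calc _ = (a ^ (t / 2) * z) * (b ^ (p / 2) * a ^ (-t) * b ^ (p / 2)) ^ (s - 1) *
          (star z * a ^ (t / 2)) := by simp only [mul_assoc]
      _ = _ := by rw [h5, h6]
  have h4 : b ^ (p / 2) * (b ^ (p / 2) * a ^ (-t) * b ^ (p / 2)) ^ (s - 1) * b ^ (p / 2) ≤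
      b ^ (p / 2) * (b ^ (p / 2) * b ^ (-t) * b ^ (p / 2)) ^ (s - 1) * b ^ (p / 2) :=
    conjugate_rpow_le_conjugate_rpow (CFC.rpow_le_rpow ⟨by linarith [hs.1], by linarith [hs.2]⟩
      (conjugate_rpow_le_conjugate_rpow (hb.rpow_neg_anti hba ht) _ _)) _ _
  rw [hb.rpow_mul_rpow_mul_rpow, hb.rpow_rpow, hb.rpow_mul_rpow_mul_rpow] at h4
  rw [h1, h3]
  refine (CFC.rpow_le_rpow ⟨by positivity, (div_le_one (by linarith)).2 hq⟩ h4).trans_eq ?_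
  rw [hb.rpow_rpow]
  convert CFC.rpow_one b hb.nonneg using 2
  rw [mul_one_div, div_eq_one_iff_eq (by linarith)]
  ring

theorem grand_furuta_inner {a b : 𝒜} (hb : IsStrictlyPositive b) (hba : b ≤ a)
    {p t s : ℝ} (hp : 1 ≤ p) (ht : t ∈ Set.Icc (0 : ℝ) 1) (hs : 1 ≤ s) :
    (a ^ (t / 2) * (a ^ (-(t / 2)) * b ^ p * a ^ (-(t / 2))) ^ s * a ^ (t / 2)) ^
      (1 / ((p - t) * s + t)) ≤ b := by
  obtain ⟨n, hn⟩ := pow_unbounded_of_one_lt s (one_lt_two)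
  induction n generalizing s with
  | zero => norm_num at hn; linarith
  | succ n ih =>
    rcases le_total s 2 with h1 | h1
    · exact grand_furuta_inner_of_le_two hb hba hp ht ⟨hs, h1⟩
    have ha := hb.of_le hba
    obtain ⟨e, rfl⟩ : ∃ e, s = e * 2 := ⟨s / 2, by ring⟩
    have he : 1 ≤ e := by linarith
    have hle := ih he (by rw [pow_succ] at hn; linarith)
    have hX := (hb.rpow_const p).conjugate (ha.rpow_const (-(t / 2)))
    have hY := (hX.rpow_const e).conjugate (ha.rpow_const (t / 2))
    have hq := one_le_sub_mul_add hp ht he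
    -- The bound for e = s / 2 gives a new operator below b. Applying the case s = 2 to it cancels
    -- the inner conjugation and doubles e.
    have key := grand_furuta_inner_of_le_two (hY.rpow_const _) (hle.trans hba) hq ht
      (s := 2) ⟨one_le_two, le_rfl⟩
    rw [hY.rpow_rpow, one_div_mul_cancel (by linarith), CFC.rpow_one _ hY.nonneg,
      ha.conjugate_rpow_neg_conjugate_rpow, hX.rpow_rpow] at key
    refine le_trans (le_of_eq ?_) (key.trans hle)
    congr 2
    ring

/-- A three-operator form of the grand Furuta inequality at the critical outer exponent. -/
theorem grand_furuta_three {a b c : 𝒜} (ha : IsStrictlyPositive a) (hab : a ≤ b) (hbc : b ≤ c)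
    {p t s : ℝ} (hp : 1 ≤ p) (ht : t ∈ Set.Icc (0 : ℝ) 1) (hs : 1 ≤ s) :
    (c ^ (t / 2) * (b ^ (-(t / 2)) * a ^ p * b ^ (-(t / 2))) ^ s * c ^ (t / 2)) ^
      (1 / ((p - t) * s + t)) ≤ c := by
  have hb := ha.of_le hab
  have hc := hb.of_le hbc
  have hq := one_le_sub_mul_add hp ht hs
  have hX := (ha.rpow_const p).conjugate (hb.rpow_const (-(t / 2)))
  -- Conjugating by b^(-t/2) gives the bound b^(1-t) ≤ c^(1-t), the form needed to exchange the
  -- outer b for c.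
  have h1 := conjugate_rpow_le_conjugate_rpow
    ((grand_furuta_inner ha hab hp ht hs).trans hab) b (-(t / 2))
  have h0 : b ^ (-(t / 2)) * b * b ^ (-(t / 2)) = b ^ (1 - t) := by
    have := hb.rpow_mul_rpow_mul_rpow (-(t / 2)) 1 (-(t / 2))
    rw [CFC.rpow_one b hb.nonneg] at this
    rw [this]
    ring_nf
  rw [h0] at h1
  have h2 := conjugate_rpow_le_of_le hb (hX.rpow_const s) hbc ht
    ⟨by positivity, (div_le_one (by linarith)).2 hq⟩
    (h1.trans (CFC.rpow_le_rpow ⟨by linarith [ht.2], by linarith [ht.1]⟩ hbc))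
  rwa [sub_add_cancel, CFC.rpow_one c hc.nonneg] at h2

/-- Passage from the critical outer exponent `t` to an arbitrary one `r ≥ t`. -/
theorem conjugate_rpow_le_rpow_sub {c x : 𝒜} (hc : IsStrictlyPositive c)
    (hx : IsStrictlyPositive x) {q t r : ℝ} (hq : 1 ≤ q) (htr : t ≤ r)
    (h : (c ^ (t / 2) * x * c ^ (t / 2)) ^ (1 / q) ≤ c) :
    (c ^ (r / 2) * x * c ^ (r / 2)) ^ ((r - t) / (q - t + r)) ≤ c ^ (r - t) := by
  have hY := hx.conjugate (hc.rpow_const (t / 2))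
  have h1 := furuta_inequality (hY.rpow_const _) h hq (sub_nonneg.2 htr)
  have h2 : c ^ ((r - t) / 2) * (c ^ (t / 2) * x * c ^ (t / 2)) * c ^ ((r - t) / 2) =
      c ^ (r / 2) * x * c ^ (r / 2) := by
    rw [hc.conjugate_rpow_conjugate_rpow]
    ring_nf
  rw [hY.rpow_rpow, one_div_mul_cancel (by linarith), CFC.rpow_one _ hY.nonneg, h2] at h1
  have hZ := hx.conjugate (hc.rpow_const (r / 2))
  have h4 : 0 < 1 + (r - t) := by linarith
  -- Löwner–Heinz lowers the exponent on c from 1 + (r - t) to r - t.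
  have h5 := CFC.rpow_le_rpow (p := (r - t) / (1 + (r - t)))
    ⟨div_nonneg (by linarith) h4.le, (div_le_one h4).2 (by linarith)⟩ h1
  rw [hZ.rpow_rpow, hc.rpow_rpow] at h5
  have h6 : 0 < q + (r - t) := by linarith
  have h7 : q - t + r ≠ 0 := by linarith
  convert h5 using 2
  · field_simp; ring
  · field_simp

/-! ### Growth of powers, for the converse. -/

/-- If conjugates of all powers of `x` by a fixed unit are bounded, then `x ≤ 1`. -/
theorem le_one_of_norm_conjugate_pow_le {x y : 𝒜} (hx : 0 ≤ x) (hy : IsUnit y) {K : ℝ}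
    (h : ∀ s : ℝ, 1 ≤ s → ‖y * x ^ s * star y‖ ≤ K) : x ≤ 1 := by
  nontriviality 𝒜
  rw [← CStarAlgebra.norm_le_one_iff_of_nonneg x hx]
  by_contra! hlt
  obtain ⟨v, rfl⟩ := hy
  have hK : ∀ n : ℕ, 1 ≤ n → ‖x‖ ^ n ≤ ‖(↑v⁻¹ : 𝒜)‖ * K * ‖star (↑v⁻¹ : 𝒜)‖ := by
    intro n hn
    have hn' : (1 : ℝ) ≤ n := by exact_mod_cast hn
    have h1 : x ^ (n : ℝ) = ↑v⁻¹ * (↑v * x ^ (n : ℝ) * star (↑v : 𝒜)) * star (↑v⁻¹ : 𝒜) := by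
      have : star (↑v : 𝒜) * star (↑v⁻¹ : 𝒜) = 1 := by
        rw [← star_mul, Units.inv_mul, star_one]
      rw [mul_assoc, mul_assoc, this, mul_one, Units.inv_mul_cancel_left]
    have h2 := CFC.norm_rpow x (r := n) (by linarith) hx
    rw [Real.rpow_natCast] at h2
    rw [← h2, h1]
    refine (norm_mul_le _ _).trans ?_
    gcongr
    refine (norm_mul_le _ _).trans ?_
    gcongr
    exact h n hn'
  obtain ⟨n, hn⟩ := pow_unbounded_of_one_lt (‖(↑v⁻¹ : 𝒜)‖ * K * ‖star (↑v⁻¹ : 𝒜)‖) hlt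
  have h3 := hK (n + 1) (by lia)
  have h4 : ‖x‖ ^ n ≤ ‖x‖ ^ (n + 1) := pow_le_pow_right₀ hlt.le (by lia)
  linarith

theorem IsStrictlyPositive.conjugate_rpow_neg_half_le_one_iff {a b : 𝒜}
    (hb : IsStrictlyPositive b) :
    b ^ (-(1 / 2) : ℝ) * a * b ^ (-(1 / 2) : ℝ) ≤ 1 ↔ a ≤ b := by
  have h : b ^ (1 / 2 : ℝ) * 1 * b ^ (1 / 2 : ℝ) = b := by
    rw [mul_one, ← hb.rpow_add]; norm_num; exact CFC.rpow_one b hb.nonneg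
  constructor <;> intro h1
  · have := conjugate_rpow_le_conjugate_rpow h1 b (1 / 2)
    rwa [hb.conjugate_rpow_conjugate_rpow_neg, h] at this
  · have := conjugate_rpow_le_conjugate_rpow h1 b (-(1 / 2))
    rwa [← hb.conjugate_rpow_neg_conjugate_rpow (1 / 2) 1, h]

end CStarAlgebra

/-! ### The nested expression and its inverse. -/

section Furuta

variable {H : Type*} [NormedAddCommGroup H] [InnerProductSpace ℂ H] [CompleteSpace H]

theorem one_le_furutaPsi {p t : ℕ → ℝ} {n : ℕ} (ht : ∀ i ∈ Finset.Icc 1 n, t i ∈ Set.Icc (0 : ℝ) 1)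
    (hp : ∀ j ∈ Finset.Icc 1 (2 * n), 1 ≤ p j) {m : ℕ} (hm : m ≤ n) : 1 ≤ furutaPsi p t m := by
  induction m with
  | zero => exact le_rfl
  | succ m ih =>
    have h1 := hp (2 * m + 1) (Finset.mem_Icc.2 (by lia))
    have h2 := hp (2 * m + 2) (Finset.mem_Icc.2 (by lia))
    have h3 := ht (m + 1) (Finset.mem_Icc.2 (by lia))
    exact one_le_sub_mul_add (one_le_mul_of_one_le_of_one_le (ih (by lia)) h1) h3 h2

theorem furutaNested_isStrictlyPositive {B : ℕ → H →L[ℂ] H} (p t : ℕ → ℝ) {n : ℕ}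
    (hB : ∀ j ∈ Finset.Icc 1 (2 * n), IsStrictlyPositive (B j)) {m : ℕ} (hm : m + 1 ≤ n) :
    IsStrictlyPositive (furutaNested B p t (m + 1)) := by
  induction m with
  | zero =>
    have h1 := hB 1 (Finset.mem_Icc.2 (by lia))
    have h2 := hB 2 (Finset.mem_Icc.2 (by lia))
    exact ((h1.rpow_const _).conjugate (h2.rpow_const _)).rpow_const _
  | succ m ih =>
    have h1 := hB (2 * m + 3) (Finset.mem_Icc.2 (by lia))
    have h2 := hB (2 * m + 4) (Finset.mem_Icc.2 (by lia))
    exact ((((ih (by lia)).conjugate (h1.rpow_const _)).rpow_const _).conjugate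
      (h2.rpow_const _)).rpow_const _

/-- The nested expression at the critical outer exponent, for an increasing chain below `C`. -/
theorem conjugate_furutaNested_rpow_le {B : ℕ → H →L[ℂ] H} {p t : ℕ → ℝ} {n : ℕ}
    (ht : ∀ i ∈ Finset.Icc 1 n, t i ∈ Set.Icc (0 : ℝ) 1)
    (hp : ∀ j ∈ Finset.Icc 1 (2 * n), 1 ≤ p j)
    (hB : ∀ j ∈ Finset.Icc 1 (2 * n), IsStrictlyPositive (B j))
    (hmono : ∀ j, 1 ≤ j → j < 2 * n → B j ≤ B (j + 1)) {m : ℕ} (hm : m + 1 ≤ n)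
    {C : H →L[ℂ] H} (hC : B (2 * m + 2) ≤ C) :
    (C ^ (t (m + 1) / 2) * furutaNested B p t (m + 1) * C ^ (t (m + 1) / 2)) ^
      (1 / furutaPsi p t (m + 1)) ≤ C := by
  induction m generalizing C with
  | zero =>
    have := grand_furuta_three (hB 1 (Finset.mem_Icc.2 (by lia)))
      (hmono 1 le_rfl (by lia)) hC (hp 1 (Finset.mem_Icc.2 (by lia)))
      (ht 1 (Finset.mem_Icc.2 (by lia))) (hp 2 (Finset.mem_Icc.2 (by lia)))
    simpa [furutaNested, furutaPsi] using this
  | succ m ih =>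
    have h3 := hB (2 * m + 3) (Finset.mem_Icc.2 (by lia))
    have h34 : B (2 * m + 3) ≤ B (2 * m + 4) := hmono (2 * m + 3) (by lia) (by lia)
    have hle := ih (by lia) (hmono (2 * m + 2) (by lia) (by lia))
    have hN := (furutaNested_isStrictlyPositive p t hB (m := m) (by lia)).conjugate
      (h3.rpow_const (t (m + 1) / 2))
    have hpsi := one_le_furutaPsi ht hp (m := m + 1) (by lia)
    have hp3 := hp (2 * m + 3) (Finset.mem_Icc.2 (by lia))
    -- The smallest operator is the previous level to the power 1/ψ. The exponent ψ p₂ₘ₊₃ cancels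
    -- that root.
    have := grand_furuta_three (hN.rpow_const _) (hle.trans h34) hC
      (one_le_mul_of_one_le_of_one_le hpsi hp3)
      (ht (m + 2) (Finset.mem_Icc.2 (by lia))) (hp (2 * m + 4) (Finset.mem_Icc.2 (by lia)))
    rw [hN.rpow_rpow, ← mul_assoc, one_div_mul_cancel (by linarith), one_mul] at this
    exact this

theorem furutaExpr_le {B : ℕ → H →L[ℂ] H} {p t : ℕ → ℝ} {n : ℕ} (hn : 1 ≤ n)
    (ht : ∀ i ∈ Finset.Icc 1 n, t i ∈ Set.Icc (0 : ℝ) 1)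
    (hp : ∀ j ∈ Finset.Icc 1 (2 * n), 1 ≤ p j)
    (hB : ∀ j ∈ Finset.Icc 1 (2 * n), IsStrictlyPositive (B j))
    (hmono : ∀ j, 1 ≤ j → j < 2 * n → B j ≤ B (j + 1)) {C : H →L[ℂ] H} (hC : B (2 * n) ≤ C)
    {r : ℝ} (hr : t n ≤ r) : furutaExpr n C B p t r ≤ C ^ (r - t n) := by
  obtain ⟨m, rfl⟩ := Nat.exists_eq_add_of_le' hn
  exact conjugate_rpow_le_rpow_sub ((hB (2 * (m + 1)) (Finset.mem_Icc.2 (by lia))).of_le hC)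
    (furutaNested_isStrictlyPositive p t hB le_rfl) (one_le_furutaPsi ht hp le_rfl) hr
    (conjugate_furutaNested_rpow_le ht hp hB hmono le_rfl hC)

/-- Inversion commutes with real powers and with conjugation once the conjugator is inverted too, so
it passes through every level. -/
theorem furutaNested_rpow_neg_one {B : ℕ → H →L[ℂ] H} (p t : ℕ → ℝ) {n : ℕ}
    (hB : ∀ j ∈ Finset.Icc 1 (2 * n), IsStrictlyPositive (B j)) {m : ℕ} (hm : m + 1 ≤ n) :
    furutaNested (fun j ↦ B j ^ (-1 : ℝ)) p t (m + 1) =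
      furutaNested B p t (m + 1) ^ (-1 : ℝ) := by
  have hinv {a : H →L[ℂ] H} (ha : IsStrictlyPositive a) (x : ℝ) :
      (a ^ (-1 : ℝ)) ^ x = (a ^ x) ^ (-1 : ℝ) := by
    rw [ha.rpow_rpow, ha.rpow_rpow, mul_comm]
  induction m with
  | zero =>
    have h1 := hB 1 (Finset.mem_Icc.2 (by lia))
    have h2 := hB 2 (Finset.mem_Icc.2 (by lia))
    simp only [furutaNested]
    rw [hinv h1, hinv h2, ← (h1.rpow_const _).conjugate_rpow_neg_one (h2.rpow_const _),
      hinv ((h1.rpow_const _).conjugate (h2.rpow_const _))]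
  | succ m ih =>
    have h3 := hB (2 * m + 3) (Finset.mem_Icc.2 (by lia))
    have h4 := hB (2 * m + 4) (Finset.mem_Icc.2 (by lia))
    have hN := furutaNested_isStrictlyPositive p t hB (m := m) (by lia)
    have hN' := hN.conjugate (h3.rpow_const (t (m + 1) / 2))
    simp only [furutaNested]
    rw [ih (by lia), hinv h3, hinv h4, ← hN.conjugate_rpow_neg_one (h3.rpow_const _), hinv hN',
      ← (hN'.rpow_const _).conjugate_rpow_neg_one (h4.rpow_const _),
      hinv ((hN'.rpow_const _).conjugate (h4.rpow_const _))]

theorem furutaExpr_isStrictlyPositive {B : ℕ → H →L[ℂ] H} (p t : ℕ → ℝ) (r : ℝ) {n : ℕ}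
    (hn : 1 ≤ n) (hB : ∀ j ∈ Finset.Icc 1 (2 * n), IsStrictlyPositive (B j)) {C : H →L[ℂ] H}
    (hC : IsStrictlyPositive C) : IsStrictlyPositive (furutaExpr n C B p t r) := by
  obtain ⟨m, rfl⟩ := Nat.exists_eq_add_of_le' hn
  exact ((furutaNested_isStrictlyPositive p t hB le_rfl).conjugate (hC.rpow_const _)).rpow_const _

theorem furutaExpr_rpow_neg_one {B : ℕ → H →L[ℂ] H} (p t : ℕ → ℝ) (r : ℝ) {n : ℕ}
    (hn : 1 ≤ n) (hB : ∀ j ∈ Finset.Icc 1 (2 * n), IsStrictlyPositive (B j)) {C : H →L[ℂ] H}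
    (hC : IsStrictlyPositive C) :
    furutaExpr n (C ^ (-1 : ℝ)) (fun j ↦ B j ^ (-1 : ℝ)) p t r =
      furutaExpr n C B p t r ^ (-1 : ℝ) := by
  obtain ⟨m, rfl⟩ := Nat.exists_eq_add_of_le' hn
  have hN := furutaNested_isStrictlyPositive p t hB le_rfl
  have hN' := hN.conjugate (hC.rpow_const (r / 2))
  rw [furutaExpr, furutaNested_rpow_neg_one p t hB le_rfl, hC.rpow_rpow, mul_comm (-1 : ℝ),
    ← hC.rpow_rpow, ← hN.conjugate_rpow_neg_one (hC.rpow_const _), hN'.rpow_rpow,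
    mul_comm (-1 : ℝ), ← hN'.rpow_rpow, furutaExpr]

theorem furutaPsi_eq_one {p t : ℕ → ℝ} (ht : ∀ i, t i = 1) (hp : ∀ j, j ≠ 2 → p j = 1) (m : ℕ) :
    furutaPsi p t m = 1 := by
  induction m with
  | zero => rfl
  | succ m ih => rw [furutaPsi, ih, ht, hp (2 * m + 1) (by lia)]; ring

/-- For `t = 1` and all powers equal to one except the second, the nested expression is a
conjugate of a power of `B₂^(-1/2) B₁ B₂^(-1/2)` by a unit that does not depend on that power. -/
theorem exists_furutaNested_eq_conjugate {B : ℕ → H →L[ℂ] H} {n : ℕ}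
    (hB : ∀ j ∈ Finset.Icc 1 (2 * n), IsStrictlyPositive (B j)) {m : ℕ} (hm : m + 1 ≤ n) :
    ∃ y : H →L[ℂ] H, IsUnit y ∧ ∀ p t : ℕ → ℝ, (∀ i, t i = 1) → (∀ j, j ≠ 2 → p j = 1) →
      furutaNested B p t (m + 1) =
        y * (B 2 ^ (-(1 / 2) : ℝ) * B 1 * B 2 ^ (-(1 / 2) : ℝ)) ^ p 2 * star y := by
  induction m with
  | zero =>
    have h1 := hB 1 (Finset.mem_Icc.2 (by lia))
    refine ⟨1, isUnit_one, fun p t ht hp ↦ ?_⟩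
    simp only [furutaNested]
    rw [ht, hp 1 (by lia), CFC.rpow_one _ h1.nonneg, one_mul, star_one, mul_one]
  | succ m ih =>
    obtain ⟨y, hy, h⟩ := ih (by lia)
    have h3 := hB (2 * m + 3) (Finset.mem_Icc.2 (by lia))
    have h4 := hB (2 * m + 4) (Finset.mem_Icc.2 (by lia))
    have hs3 := (h3.rpow_const (1 / 2)).isSelfAdjoint.star_eq
    have hs4 := (h4.rpow_const (-(1 / 2))).isSelfAdjoint.star_eq
    refine ⟨B (2 * m + 4) ^ (-(1 / 2) : ℝ) * (B (2 * m + 3) ^ (1 / 2 : ℝ) * y),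
      (h4.rpow_const _).isUnit.mul ((h3.rpow_const _).isUnit.mul hy), fun p t ht hp ↦ ?_⟩
    have hN := (furutaNested_isStrictlyPositive p t hB (m := m) (by lia)).conjugate
      (h3.rpow_const (1 / 2))
    simp only [furutaNested]
    rw [ht, ht, hp (2 * m + 3) (by lia), hp (2 * m + 4) (by lia), CFC.rpow_one _ hN.nonneg,
      CFC.rpow_one _ (hN.conjugate (h4.rpow_const _)).nonneg, h p t ht hp, star_mul, star_mul,
      hs3, hs4]
    simp only [mul_assoc]

theorem le_of_furutaExpr_le {B : ℕ → H →L[ℂ] H} {n : ℕ} (hn : 1 ≤ n)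
    (hB : ∀ j ∈ Finset.Icc 1 (2 * n), IsStrictlyPositive (B j)) {C : H →L[ℂ] H}
    (hC : IsStrictlyPositive C)
    (h : ∀ t p : ℕ → ℝ, (∀ i ∈ Finset.Icc 1 n, t i ∈ Set.Icc (0 : ℝ) 1) →
      (∀ j ∈ Finset.Icc 1 (2 * n), 1 ≤ p j) → ∀ r : ℝ, t n ≤ r →
        furutaExpr n C B p t r ≤ C ^ (r - t n)) : B 1 ≤ B 2 := by
  have h1 := hB 1 (Finset.mem_Icc.2 (by lia))
  have h2 := hB 2 (Finset.mem_Icc.2 (by lia))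
  rw [← h2.conjugate_rpow_neg_half_le_one_iff]
  obtain ⟨m, rfl⟩ := Nat.exists_eq_add_of_le' hn
  obtain ⟨y, hy, hN⟩ := exists_furutaNested_eq_conjugate hB (m := m) le_rfl
  refine le_one_of_norm_conjugate_pow_le (h1.conjugate (h2.rpow_const _)).nonneg (hC.isUnit.mul hy)
    (K := ‖C‖ ^ 2) fun s hs ↦ ?_
  have hp : ∀ j, j ≠ 2 → Function.update (fun _ ↦ (1 : ℝ)) 2 s j = 1 := fun j hj ↦ by simp [hj]
  -- Here ψ = 1, so r = 2 makes the outer power 1/2 and the conjugator C itself, whatever s is.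
  have key := h (fun _ ↦ 1) (Function.update (fun _ ↦ 1) 2 s) (fun _ _ ↦ ⟨zero_le_one, le_rfl⟩)
    (fun j _ ↦ by
      rcases eq_or_ne j 2 with rfl | hj
      · simpa using hs
      · rw [hp j hj]) 2 one_le_two
  rw [furutaExpr, furutaPsi_eq_one (fun _ ↦ rfl) hp, hN _ _ (fun _ ↦ rfl) hp,
    Function.update_self, div_self two_ne_zero, show (2 : ℝ) - 1 = 1 by norm_num,
    show (1 : ℝ) - 1 + 2 = 2 by norm_num, CFC.rpow_one C hC.nonneg] at key
  set X := (B 2 ^ (-(1 / 2) : ℝ) * B 1 * B 2 ^ (-(1 / 2) : ℝ)) ^ s with hX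
  have hY : C * (y * X * star y) * C = C * y * X * star (C * y) := by
    rw [star_mul, hC.isSelfAdjoint.star_eq]
    simp only [mul_assoc]
  rw [hY] at key
  have hpos : 0 ≤ C * y * X * star (C * y) :=
    star_right_conjugate_nonneg CFC.rpow_nonneg _
  have h3 := CStarAlgebra.norm_le_norm_of_nonneg_of_le CFC.rpow_nonneg key
  -- The norm of the square root is the square root of the norm; squaring yields the constant ‖C‖².
  rw [CFC.norm_rpow _ (by norm_num) hpos] at h3
  have h4 := Real.rpow_le_rpow (by positivity) h3 zero_le_two
  rw [← Real.rpow_mul (norm_nonneg _)] at h4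
  simpa using h4

end Furuta

theorem theorem2p1 {H : Type*} [NormedAddCommGroup H] [InnerProductSpace ℂ H] [CompleteSpace H]
    (n : ℕ) (hn : 1 ≤ n) (A : ℕ → H →L[ℂ] H)
    (hA : ∀ i ∈ Finset.Icc 1 (2 * n + 1), IsStrictlyPositive (A i)) :
    (∀ i ∈ Finset.Icc 1 (2 * n), A i ≤ A (i + 1)) ↔
      ∀ t p : ℕ → ℝ, (∀ i ∈ Finset.Icc 1 n, t i ∈ Set.Icc (0 : ℝ) 1) →
        (∀ j ∈ Finset.Icc 1 (2 * n), 1 ≤ p j) →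
        ∀ r : ℝ, t n ≤ r →
          (∀ k < n,
            furutaExpr n (A (2 * n + 1)) (fun j => A (min (k + j) (2 * n + 1))) p t r ≤
              A (2 * n + 1) ^ (r - t n)) ∧
          (∀ k < n,
            A 1 ^ (r - t n) ≤
              furutaExpr n (A 1) (fun j => A (2 * n + 2 - min (k + j) (2 * n + 1))) p t r) := by
  have hA1 : IsStrictlyPositive (A 1) := hA 1 (Finset.mem_Icc.2 (by lia))
  have hAn : IsStrictlyPositive (A (2 * n + 1)) := hA _ (Finset.mem_Icc.2 (by lia))
  have hB (k : ℕ) : ∀ j ∈ Finset.Icc 1 (2 * n), IsStrictlyPositive (A (min (k + j) (2 * n + 1))) :=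
    fun j hj ↦ hA _ (Finset.mem_Icc.2 (by rw [Finset.mem_Icc] at hj; lia))
  have hB' (k : ℕ) : ∀ j ∈ Finset.Icc 1 (2 * n),
      IsStrictlyPositive (A (2 * n + 2 - min (k + j) (2 * n + 1))) :=
    fun j hj ↦ hA _ (Finset.mem_Icc.2 (by rw [Finset.mem_Icc] at hj; lia))
  have hinv (t p : ℕ → ℝ) (r : ℝ) (k : ℕ) :
      A 1 ^ (r - t n) ≤
          furutaExpr n (A 1) (fun j => A (2 * n + 2 - min (k + j) (2 * n + 1))) p t r ↔
        furutaExpr n (A 1 ^ (-1 : ℝ))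
          (fun j => A (2 * n + 2 - min (k + j) (2 * n + 1)) ^ (-1 : ℝ)) p t r ≤
            (A 1 ^ (-1 : ℝ)) ^ (r - t n) := by
    rw [furutaExpr_rpow_neg_one p t r hn (hB' k) hA1, hA1.rpow_rpow, mul_comm (-1 : ℝ),
      ← hA1.rpow_rpow,
      (hA1.rpow_const _).rpow_neg_one_le_rpow_neg_one_iff
        (furutaExpr_isStrictlyPositive p t r hn (hB' k) hA1)]
  simp only [hinv]
  constructor
  · intro h t p ht hp r hr
    have hmono : ∀ i j, 1 ≤ i → i ≤ j → j ≤ 2 * n + 1 → A i ≤ A j := by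
      intro i j hi hij
      induction j, hij using Nat.le_induction with
      | base => exact fun _ ↦ le_rfl
      | succ j hij ih => exact fun hj ↦ (ih (by lia)).trans (h j (Finset.mem_Icc.2 (by lia)))
    refine ⟨fun k hk ↦ furutaExpr_le hn ht hp (hB k) (fun j hj hj' ↦ ?_) ?_ hr,
      fun k hk ↦ furutaExpr_le hn ht hp (fun j hj ↦ (hB' k j hj).rpow_const _)
        (fun j hj hj' ↦ ?_) ?_ hr⟩
    · exact hmono _ _ (by lia) (by lia) (by lia)
    · exact hmono _ _ (by lia) (by lia) (by lia)
    · exact (hA _ (Finset.mem_Icc.2 (by lia))).rpow_neg_one_anti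
        (hmono _ _ (by lia) (by lia) (by lia))
    · exact hA1.rpow_neg_one_anti (hmono _ _ (by lia) (by lia) (by lia))
  · intro h i hi
    rw [Finset.mem_Icc] at hi
    rcases le_or_gt i n with hin | hin
    -- The upper bounds supply the links with i ≤ n; the lower bounds, read for inverses, supply
    -- those with i > n.
    · have := le_of_furutaExpr_le hn (hB (i - 1)) hAn
        fun t p ht hp r hr ↦ (h t p ht hp r hr).1 (i - 1) (by lia)
      rwa [show min (i - 1 + 1) (2 * n + 1) = i by lia,
        show min (i - 1 + 2) (2 * n + 1) = i + 1 by lia] at this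
    · have := le_of_furutaExpr_le hn
        (fun j hj ↦ (hB' (2 * n - i) j hj).rpow_const (-1)) (hA1.rpow_const _)
        fun t p ht hp r hr ↦ (h t p ht hp r hr).2 (2 * n - i) (by lia)
      rw [show 2 * n + 2 - min (2 * n - i + 1) (2 * n + 1) = i + 1 by lia,
        show 2 * n + 2 - min (2 * n - i + 2) (2 * n + 1) = i by lia] at this
      exact ((hA i (Finset.mem_Icc.2 (by lia))).rpow_neg_one_le_rpow_neg_one_iff
        (hA (i + 1) (Finset.mem_Icc.2 (by lia)))).1 this
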